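/- Let $n\ge 2$ and let $W:\mathbb{R}^n\times\mathbb{S}^{n-1}\to\mathbb{C}$ be continuous and bounded, with $$w_0(x)=\frac{1}{|\mathbb{S}^{n-1}|}\int_{\mathbb{S}^{n-1}}W(x,\theta)\,d\theta\neq 0\quad\text{for all }x\in\mathbb{R}^n,$$ where $d\theta$ is the standard measure on $\mathbb{S}^{n-1}$. For $f\in C_0(\mathbb{R}^n)$ (continuous, compactly supported, complex-valued) put $$R_Wf(s,\theta)=\int_{x\cdot\theta=s}W(x,\theta)f(x)\,dx,\qquad (s,\theta)\in\mathbb{R}\times\mathbb{S}^{n-1},$$ where $dx$ is Lebesgue measure on the hyperplane, and let $[R_Wf]^{(n-1)}=\frac{d^{n-1}}{ds^{n-1}}R_Wf(s,\theta)$ and $\mathbb{H}\phi(s)=\frac1\pi\,\mathrm{p.v.}\!\int_{\mathbb{R}}\frac{\phi(t)}{s-t}\,dt$. Define $$f_{appr}(x)=\frac{(-1)^{(n-2)/2}}{2(2\pi)^{n-1}w_0(x)}\int_{\mathbb{S}^{n-1}}\mathbb{H}[R_Wf]^{(n-1)}(x\cdot\theta,\theta)\,d\theta\quad\text{for } n\text{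 even},$$ $$f_{appr}(x)=\frac{(-1)^{(n-1)/2}}{2(2\pi)^{n-1}w_0(x)}\int_{\mathbb{S}^{n-1}}[R_Wf]^{(n-1)}(x\cdot\theta,\theta)\,d\theta\quad\text{for } n\text{ odd}.$$ Here derivatives, the Hilbert transform, the substitution $s=x\cdot\theta$ and the integral over $\theta$ are taken in the sense of distributions; as $w_0$ is continuous and never zero, the equality $f_{appr}=f$ in the sense of distributions means $w_0f_{appr}=w_0f$ as distributions on $\mathbb{R}^n$, where $w_0f_{appr}$ is the right-hand side with the factor $1/w_0(x)$ removed. Then $f_{appr}=f$ in the sense of distributions on $\mathbb{R}^n$ for all $f\in C_0(\mathbb{R}^n)$ if and only if $$W(x,\theta)-w_0(x)=w_0(x)-W(x,-\theta)\quad\text{for all }x\in\mathbb{R}^n,\ \theta\in\mathbb{S}^{n-1}.$$ -/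

import Mathlib

open MeasureTheory Filter Topology
open scoped Distributions

noncomputable section

namespace ChangRadon

/-- The unit sphere of `ℝⁿ`. -/
abbrev Sph (n : ℕ) : Type := Metric.sphere (0 : EuclideanSpace ℝ (Fin n)) 1

/-- The standard (surface) measure on the unit sphere of `ℝⁿ`. -/
def sphereMeasure (n : ℕ) : Measure (Sph n) :=
  (volume : Measure (EuclideanSpace ℝ (Fin n))).toSphere

/-- The spherical mean `w₀(x) = |S^{n-1}|⁻¹ ∫ W(x,θ) dθ`. -/
def w0 {n : ℕ} (W : EuclideanSpace ℝ (Fin n) × Sph n → ℂ) (x : EuclideanSpace ℝ (Fin n)) : ℂ :=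
  (1 / ((sphereMeasure n).real Set.univ : ℂ)) * ∫ θ, W (x, θ) ∂(sphereMeasure n)

/-- `∫_{x·θ = s} h(x) dx`. The hyperplane is parametrized by `y ↦ s θ + y`, `y ⊥ θ`, and `θ^⊥`
carries its Lebesgue measure (unit cubes of orthonormal bases have measure one; it is written out
because `volume` on the subtype could be read as the restriction of the measure of `ℝⁿ`). -/
def hyperplaneIntegral {n : ℕ} (h : EuclideanSpace ℝ (Fin n) → ℂ) (s : ℝ) (θ : Sph n) : ℂ :=
  ∫ y : (Submodule.span ℝ {(θ : EuclideanSpace ℝ (Fin n))})ᗮ,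
    h (s • (θ : EuclideanSpace ℝ (Fin n)) + (y : EuclideanSpace ℝ (Fin n)))
    ∂((stdOrthonormalBasis ℝ
        (Submodule.span ℝ {(θ : EuclideanSpace ℝ (Fin n))})ᗮ).toBasis.addHaar)

/-- The weighted Radon transform `R_W f(s,θ) = ∫_{x·θ = s} W(x,θ) f(x) dx`. -/
def weightedRadon {n : ℕ} (W : EuclideanSpace ℝ (Fin n) × Sph n → ℂ)
    (f : EuclideanSpace ℝ (Fin n) → ℂ) (s : ℝ) (θ : Sph n) : ℂ :=
  hyperplaneIntegral (fun x => W (x, θ) * f x) s θ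

/-- The Hilbert transform `Hψ(s) = π⁻¹ p.v. ∫ ψ(t) / (s - t) dt`. It is only evaluated at test
functions `ψ`, for which the principal value exists at every `s`. -/
def hilbert (ψ : ℝ → ℂ) (s : ℝ) : ℂ :=
  limUnder (𝓝[>] (0 : ℝ)) fun ε : ℝ =>
    (1 / (Real.pi : ℂ)) * ∫ t in {t : ℝ | ε < |s - t|}, ψ t / ((s : ℂ) - (t : ℂ))

/-! Distributions are represented by their pairings with (test) functions. A compactly supported
distribution on `ℝ` is paired with every smooth function. -/

/-- The distribution on `ℝ` given by a function: `⟨g, ψ⟩ = ∫ g ψ`. -/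
def ofFun (g : ℝ → ℂ) : (ℝ → ℂ) → ℂ := fun ψ => ∫ s, g s * ψ s

/-- The `k`-th derivative of a distribution on `ℝ`: `⟨T^{(k)}, ψ⟩ = (-1)^k ⟨T, ψ^{(k)}⟩`. -/
def distDeriv (k : ℕ) (T : (ℝ → ℂ) → ℂ) : (ℝ → ℂ) → ℂ :=
  fun ψ => (-1) ^ k * T (iteratedDeriv k ψ)

/-- The Hilbert transform of a compactly supported distribution on `ℝ`, i.e. its convolution with
`π⁻¹ p.v. 1/s`: as this kernel is odd, `⟨H T, ψ⟩ = -⟨T, H ψ⟩`. -/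
def distHilbert (T : (ℝ → ℂ) → ℂ) : (ℝ → ℂ) → ℂ :=
  fun ψ => - T (hilbert ψ)

/-- The distribution `T(x·θ)` on `ℝⁿ`, the pull-back of `T` under `x ↦ x·θ`:
`⟨T(x·θ), φ⟩ = ⟨T, s ↦ ∫_{x·θ = s} φ(x) dx⟩`. -/
def ridge {n : ℕ} (θ : Sph n) (T : (ℝ → ℂ) → ℂ) : (EuclideanSpace ℝ (Fin n) → ℂ) → ℂ :=
  fun φ => T fun s => hyperplaneIntegral φ s θ

/-- The distribution `[R_W f]^{(n-1)}(·,θ)` on `ℝ`. -/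
def radonDeriv {n : ℕ} (W : EuclideanSpace ℝ (Fin n) × Sph n → ℂ)
    (f : EuclideanSpace ℝ (Fin n) → ℂ) (θ : Sph n) : (ℝ → ℂ) → ℂ :=
  distDeriv (n - 1) (ofFun fun s => weightedRadon W f s θ)

/-- The distribution `w₀ f_appr` on `ℝⁿ`:
`(-1)^{(n-2)/2} / (2 (2π)^{n-1}) ∫ H[R_W f]^{(n-1)}(x·θ, θ) dθ` for even `n`,
`(-1)^{(n-1)/2} / (2 (2π)^{n-1}) ∫ [R_W f]^{(n-1)}(x·θ, θ) dθ` for odd `n`. -/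
def changNumerator {n : ℕ} (W : EuclideanSpace ℝ (Fin n) × Sph n → ℂ)
    (f : EuclideanSpace ℝ (Fin n) → ℂ) : (EuclideanSpace ℝ (Fin n) → ℂ) → ℂ :=
  fun φ =>
    if Even n then
      (-1) ^ ((n - 2) / 2) / (2 * (2 * (Real.pi : ℂ)) ^ (n - 1)) *
        ∫ θ, ridge θ (distHilbert (radonDeriv W f θ)) φ ∂(sphereMeasure n)
    else
      (-1) ^ ((n - 1) / 2) / (2 * (2 * (Real.pi : ℂ)) ^ (n - 1)) *
        ∫ θ, ridge θ (radonDeriv W f θ) φ ∂(sphereMeasure n)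

/-- `T / w = f` in the sense of distributions on `ℝⁿ`, where `w` is continuous and never zero and
`f` is continuous: `T = w f`, i.e. `⟨T, φ⟩ = ∫ w f φ` for all smooth compactly supported
`φ : ℝⁿ → ℂ`. -/
def QuotientEq {n : ℕ} (T : (EuclideanSpace ℝ (Fin n) → ℂ) → ℂ)
    (w f : EuclideanSpace ℝ (Fin n) → ℂ) : Prop :=
  ∀ φ : 𝓓((⊤ : TopologicalSpace.Opens (EuclideanSpace ℝ (Fin n))), ℂ), T φ = ∫ x, w x * f x * φ x

/-- `f_appr = f` in the sense of distributions, where `f_appr = (w₀ f_appr) / w₀` is given by the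
Chang-type formulas from `R_W f` and `w₀`. -/
def ChangExact {n : ℕ} (W : EuclideanSpace ℝ (Fin n) × Sph n → ℂ)
    (f : EuclideanSpace ℝ (Fin n) → ℂ) : Prop :=
  QuotientEq (changNumerator W f) (w0 W) f

end ChangRadon

end

noncomputable section

open scoped RealInnerProductSpace FourierTransform SchwartzMap

namespace ChangRadon

/-! Everything is moved onto the test function `φ`. On the Fourier side the derivatives, the Hilbert
transform (for even `n`) and the constants combine, in either parity, into the multiplier `|σ|^(n-1)
/ 2` acting on the Radon transform of `φ` (`odd_normalization`, `even_normalization`). By Fubini,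
`w₀ f_appr` paired with `φ` is `∫ f · Bφ`, where `Bφ = backproj W φ` integrates `W(x,θ)` against the
filtered data at `s = x·θ` (`changNumerator_eq_integral_backproj`).

By the Fourier slice theorem and polar coordinates, where `|σ|^(n-1)` is the Jacobian, `Bφ(x) = ∫
a(x,ξ) e^{2πi x·ξ} φ̂(ξ) dξ`. Here `a(x,ξ)` is the even part of `W(x,·)` at `ξ/|ξ|`
(`backproj_eq_integral_evenSymbol`). The odd part of `W` is invisible.

If the even part is `w₀(x)`, Fourier inversion gives `Bφ = w₀ φ`, hence exactness. Conversely,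
exactness for all `f` forces `Bφ = w₀ φ` pointwise (`backproj_eq_of_changExact`). Applying this to a
bump at `x` modulated by `e^{2πi t y·ω}` and letting `t → ∞` isolates `a(x,ω)`, because the symbol
is homogeneous of degree `0` (`even_part_of_backproj_eq`). -/

variable {n : ℕ}

/-! ### Hyperplane integrals: Fubini and the Fourier slice theorem. -/

/-- The isometry `(s, y) ↦ s θ + y` from `ℝ × θ^⊥` onto `ℝⁿ`. -/
def hyperplaneIso (θ : Sph n) :
    WithLp 2 (ℝ × (Submodule.span ℝ {(θ : EuclideanSpace ℝ (Fin n))})ᗮ) ≃ₗᵢ[ℝ]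
      EuclideanSpace ℝ (Fin n) :=
  (LinearIsometryEquiv.withLpProdCongr 2
    (LinearIsometryEquiv.toSpanUnitSingleton (𝕜 := ℝ) (θ : EuclideanSpace ℝ (Fin n)) (by simp))
    (LinearIsometryEquiv.refl ℝ _)).trans
    (Submodule.span ℝ {(θ : EuclideanSpace ℝ (Fin n))}).orthogonalDecomposition.symm

lemma hyperplaneIso_toLp (θ : Sph n) (s : ℝ)
    (y : (Submodule.span ℝ {(θ : EuclideanSpace ℝ (Fin n))})ᗮ) :
    hyperplaneIso θ (WithLp.toLp 2 (s, y)) = s • (θ : EuclideanSpace ℝ (Fin n)) + y := by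
  simp [hyperplaneIso]

/-- Lebesgue measure on `θ^⊥`. -/
abbrev orthMeasure (θ : Sph n) :
    Measure (Submodule.span ℝ {(θ : EuclideanSpace ℝ (Fin n))})ᗮ :=
  (stdOrthonormalBasis ℝ
    (Submodule.span ℝ {(θ : EuclideanSpace ℝ (Fin n))})ᗮ).toBasis.addHaar

lemma measurePreserving_hyperplane (θ : Sph n) :
    MeasurePreserving (fun p : ℝ × (Submodule.span ℝ {(θ : EuclideanSpace ℝ (Fin n))})ᗮ =>
      p.1 • (θ : EuclideanSpace ℝ (Fin n)) + (p.2 : EuclideanSpace ℝ (Fin n)))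
      ((volume : Measure ℝ).prod (orthMeasure θ)) volume := by
  have h := (hyperplaneIso θ).measurePreserving.comp (WithLp.volume_preserving_toLp ℝ
    (Submodule.span ℝ {(θ : EuclideanSpace ℝ (Fin n))})ᗮ)
  convert! h using 1

lemma measurableEmbedding_hyperplane (θ : Sph n) :
    MeasurableEmbedding (fun p : ℝ × (Submodule.span ℝ {(θ : EuclideanSpace ℝ (Fin n))})ᗮ =>
      p.1 • (θ : EuclideanSpace ℝ (Fin n)) + (p.2 : EuclideanSpace ℝ (Fin n))) := by
  have h := (hyperplaneIso θ).toHomeomorph.measurableEmbedding.comp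
    (MeasurableEquiv.toLp 2 (ℝ × (Submodule.span ℝ
      {(θ : EuclideanSpace ℝ (Fin n))})ᗮ)).measurableEmbedding
  convert! h using 1

lemma inner_hyperplane (θ : Sph n) (s : ℝ)
    (y : (Submodule.span ℝ {(θ : EuclideanSpace ℝ (Fin n))})ᗮ) :
    ⟪s • (θ : EuclideanSpace ℝ (Fin n)) + y, (θ : EuclideanSpace ℝ (Fin n))⟫ = s := by
  have h : ⟪(y : EuclideanSpace ℝ (Fin n)), (θ : EuclideanSpace ℝ (Fin n))⟫ = 0 :=
    Submodule.mem_orthogonal_singleton_iff_inner_left.mp y.2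
  rw [inner_add_left, h, inner_smul_left, real_inner_self_eq_norm_sq]
  simp

lemma norm_le_norm_hyperplane (θ : Sph n) (s : ℝ)
    (y : (Submodule.span ℝ {(θ : EuclideanSpace ℝ (Fin n))})ᗮ) :
    ‖y‖ ≤ ‖s • (θ : EuclideanSpace ℝ (Fin n)) + y‖ := by
  rw [← hyperplaneIso_toLp, LinearIsometryEquiv.norm_map]
  exact WithLp.norm_snd_le _ (WithLp.toLp 2 (s, y))

lemma integrable_hyperplane {h : EuclideanSpace ℝ (Fin n) → ℂ} (hh : Integrable h) (θ : Sph n) :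
    Integrable (fun p : ℝ × (Submodule.span ℝ {(θ : EuclideanSpace ℝ (Fin n))})ᗮ =>
      h (p.1 • (θ : EuclideanSpace ℝ (Fin n)) + (p.2 : EuclideanSpace ℝ (Fin n))))
      ((volume : Measure ℝ).prod (orthMeasure θ)) :=
  (measurePreserving_hyperplane θ).integrable_comp_of_integrable hh

lemma integrable_hyperplaneIntegral {h : EuclideanSpace ℝ (Fin n) → ℂ} (hh : Integrable h)
    (θ : Sph n) : Integrable (fun s => hyperplaneIntegral h s θ) :=
  (integrable_hyperplane hh θ).integral_prod_left

lemma integral_hyperplaneIntegral {h : EuclideanSpace ℝ (Fin n) → ℂ} (hh : Integrable h)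
    (θ : Sph n) : ∫ s, hyperplaneIntegral h s θ = ∫ x, h x := by
  rw [← (measurePreserving_hyperplane θ).integral_comp (measurableEmbedding_hyperplane θ),
    integral_prod _ (integrable_hyperplane hh θ)]
  rfl

lemma hyperplaneIntegral_mul_inner (h : EuclideanSpace ℝ (Fin n) → ℂ) (g : ℝ → ℂ) (s : ℝ)
    (θ : Sph n) :
    hyperplaneIntegral (fun x => h x * g ⟪x, (θ : EuclideanSpace ℝ (Fin n))⟫) s θ =
      hyperplaneIntegral h s θ * g s := by
  simp only [hyperplaneIntegral, inner_hyperplane]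
  rw [integral_mul_const]

lemma integral_hyperplaneIntegral_mul {h : EuclideanSpace ℝ (Fin n) → ℂ} {g : ℝ → ℂ} {θ : Sph n}
    (hh : Integrable fun x => h x * g ⟪x, (θ : EuclideanSpace ℝ (Fin n))⟫) :
    ∫ s, hyperplaneIntegral h s θ * g s =
      ∫ x, h x * g ⟪x, (θ : EuclideanSpace ℝ (Fin n))⟫ := by
  rw [← integral_hyperplaneIntegral hh θ]
  simp only [hyperplaneIntegral_mul_inner]

/-- Since `|y| ≤ |sθ + y|`, the restrictions of `h` to all the parallel hyperplanes are supported in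
one ball of `θ^⊥`. -/
lemma continuous_hyperplaneIntegral {h : EuclideanSpace ℝ (Fin n) → ℂ} (hc : Continuous h)
    (hs : HasCompactSupport h) (θ : Sph n) :
    Continuous (fun s => hyperplaneIntegral h s θ) := by
  obtain ⟨R, hR⟩ := hs.isCompact.isBounded.subset_closedBall 0
  rw [← continuousOn_univ]
  refine continuousOn_integral_of_compact_support
    (isCompact_closedBall (0 : (Submodule.span ℝ {(θ : EuclideanSpace ℝ (Fin n))})ᗮ) R)
    (Continuous.continuousOn (by fun_prop)) fun s y _ hy => ?_
  by_contra hne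
  refine hy ?_
  have := hR (subset_tsupport _ (Function.mem_support.mpr hne))
  rw [mem_closedBall_zero_iff] at this ⊢
  exact (norm_le_norm_hyperplane θ s y).trans this

/-- The Fourier slice theorem. -/
lemma fourier_hyperplaneIntegral {h : EuclideanSpace ℝ (Fin n) → ℂ} (hh : Integrable h)
    (θ : Sph n) (σ : ℝ) :
    𝓕 (fun s => hyperplaneIntegral h s θ) σ =
      𝓕 h (σ • (θ : EuclideanSpace ℝ (Fin n))) := by
  have key := (Real.fourierIntegral_convergent_iff (μ := volume) (f := h)
    (σ • (θ : EuclideanSpace ℝ (Fin n)))).mpr hh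
  have e : ∀ x : EuclideanSpace ℝ (Fin n),
      Real.fourierChar (-⟪x, σ • (θ : EuclideanSpace ℝ (Fin n))⟫) • h x =
      h x * (Real.fourierChar (-(⟪x, (θ : EuclideanSpace ℝ (Fin n))⟫ * σ)) : ℂ) := by
    intro x
    rw [inner_smul_right, Circle.smul_def, smul_eq_mul, mul_comm, mul_comm σ]
  rw [Real.fourier_real_eq, Real.fourier_eq]
  simp_rw [e] at key ⊢
  rw [← integral_hyperplaneIntegral_mul
    (g := fun s => (Real.fourierChar (-(s * σ)) : ℂ)) key]
  simp only [Circle.smul_def, smul_eq_mul, mul_comm]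

/-- The restriction of the Fourier transform of `φ` to the line `ℝ θ`. -/
def slice (φ : 𝓢(EuclideanSpace ℝ (Fin n), ℂ)) (θ : Sph n) : 𝓢(ℝ, ℂ) :=
  SchwartzMap.compCLMOfAntilipschitz (K := 1) ℂ
    (g := fun σ : ℝ => σ • (θ : EuclideanSpace ℝ (Fin n)))
    (by fun_prop)
    (AntilipschitzWith.of_le_mul_dist fun x y => by
      rw [dist_eq_norm, dist_eq_norm, ← sub_smul, norm_smul]; simp) (𝓕 φ)

lemma slice_apply (φ : 𝓢(EuclideanSpace ℝ (Fin n), ℂ)) (θ : Sph n) (σ : ℝ) :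
    slice φ θ σ = 𝓕 φ (σ • (θ : EuclideanSpace ℝ (Fin n))) := rfl

/-- By the slice theorem the Fourier transform is `slice φ θ`, and inversion holds pointwise by
continuity. The Radon transform of `φ` is thus Schwartz in `s`, with no differentiation under the
hyperplane integral. -/
lemma hyperplaneIntegral_eq_fourierInv (φ : 𝓢(EuclideanSpace ℝ (Fin n), ℂ))
    (hs : HasCompactSupport φ) (θ : Sph n) :
    (fun s => hyperplaneIntegral φ s θ) = 𝓕⁻ (slice φ θ) := by
  have hf : 𝓕 (fun s => hyperplaneIntegral φ s θ) = slice φ θ := by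
    funext σ
    rw [fourier_hyperplaneIntegral φ.integrable, slice_apply, SchwartzMap.fourier_coe]
  rw [SchwartzMap.fourierInv_coe, ← hf, (continuous_hyperplaneIntegral φ.continuous hs
    θ).fourierInv_fourier_eq (integrable_hyperplaneIntegral φ.integrable θ)]
  rw [hf]
  exact (slice φ θ).integrable

/-! ### Principal values and the Hilbert transform as a Fourier multiplier. -/

lemma exists_norm_sub_le (g : 𝓢(ℝ, ℂ)) : ∃ K : ℝ, ∀ a b : ℝ, ‖g a - g b‖ ≤ K * |a - b| := by
  obtain ⟨C, hC⟩ := g.decay 0 1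
  refine ⟨C, fun a b => ?_⟩
  have := Convex.norm_image_sub_le_of_norm_fderiv_le (𝕜 := ℝ) (f := g) (s := Set.univ) (C := C)
    (fun x _ => g.differentiableAt) (fun x _ => by
      simpa [norm_iteratedFDeriv_one] using hC.2 x) convex_univ (Set.mem_univ b) (Set.mem_univ a)
  simpa using this

/-- The Lipschitz bound controls the quotient for `|u| ≤ 1`; elsewhere `|u|⁻¹ ≤ 1`. This is the
dominating function for principal values. -/
lemma integrable_diff_div (g : 𝓢(ℝ, ℂ)) (s : ℝ) :
    Integrable fun u : ℝ => ‖g (s - u) - g (s + u)‖ * |u|⁻¹ := by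
  obtain ⟨K, hK⟩ := exists_norm_sub_le g
  have hD : Integrable fun u : ℝ => ‖g (s - u) - g (s + u)‖ :=
    ((g.integrable.comp_sub_left s).sub (g.integrable.comp_add_left s)).norm
  have hI : Integrable ((Set.Icc (-1 : ℝ) 1).indicator fun _ => K * 2) :=
    (integrable_indicator_iff measurableSet_Icc).mpr continuous_const.integrableOn_Icc
  refine (hI.add hD).mono' (by fun_prop) (Eventually.of_forall fun u => ?_)
  rw [Real.norm_of_nonneg (by positivity), Pi.add_apply]
  by_cases hu : u ∈ Set.Icc (-1 : ℝ) 1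
  · rw [Set.indicator_of_mem hu]
    have h := hK (s - u) (s + u)
    have e : |s - u - (s + u)| = 2 * |u| := by
      rw [show s - u - (s + u) = -(2 * u) by ring, abs_neg, abs_mul]; norm_num
    rw [e] at h
    have : ‖g (s - u) - g (s + u)‖ * |u|⁻¹ ≤ K * 2 := by
      rcases eq_or_ne u 0 with rfl | h0
      · have h1 := hK 1 0
        rw [sub_zero, abs_one, mul_one] at h1
        simpa using (norm_nonneg _).trans h1
      · rw [← div_eq_mul_inv, div_le_iff₀ (abs_pos.mpr h0)]
        linarith
    have := norm_nonneg (g (s - u) - g (s + u))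
    linarith
  · rw [Set.indicator_of_notMem hu, zero_add]
    refine mul_le_of_le_one_right (norm_nonneg _) (inv_le_one_of_one_le₀ ?_)
    rw [Set.mem_Icc, ← abs_le, not_le] at hu
    exact hu.le

/-- Integrals against truncations of the kernel `1 / u` tend to the principal value. -/
lemma tendsto_integral_odd_kernel (g : 𝓢(ℝ, ℂ)) (s : ℝ) (k : ℝ → ℝ → ℝ)
    (hmeas : ∀ ε, Measurable (k ε)) (hodd : ∀ ε u, k ε (-u) = -k ε u)
    (hle : ∀ ε, 0 < ε → ∀ u, |k ε u| ≤ |u|⁻¹) (hbdd : ∀ ε, 0 < ε → ∃ C, ∀ u, |k ε u| ≤ C)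
    (hlim : ∀ u, u ≠ 0 → Tendsto (fun ε => k ε u) (𝓝[>] 0) (𝓝 u⁻¹)) :
    Tendsto (fun ε => ∫ u : ℝ, g (s - u) * (k ε u : ℂ)) (𝓝[>] 0)
      (𝓝 (1 / 2 * ∫ u : ℝ, (g (s - u) - g (s + u)) * ((u⁻¹ : ℝ) : ℂ))) := by
  have hpos : ∀ᶠ ε : ℝ in 𝓝[>] 0, 0 < ε := eventually_mem_nhdsWithin
  -- Oddness of the kernel allows `g` to be replaced by half a difference vanishing at `u = 0`,
  -- which compensates the singularity `|u|⁻¹`.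
  have key : ∀ ε, 0 < ε → ∫ u : ℝ, g (s - u) * (k ε u : ℂ) =
      1 / 2 * ∫ u : ℝ, (g (s - u) - g (s + u)) * (k ε u : ℂ) := by
    intro ε hε
    obtain ⟨C, hC⟩ := hbdd ε hε
    have hm : AEStronglyMeasurable (fun u => (k ε u : ℂ)) :=
      (Complex.measurable_ofReal.comp (hmeas ε)).aestronglyMeasurable
    have hb : ∀ᵐ u : ℝ, ‖(k ε u : ℂ)‖ ≤ C := Eventually.of_forall fun u => by simpa using hC u
    have i1 : Integrable fun u : ℝ => g (s - u) * (k ε u : ℂ) :=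
      (g.integrable.comp_sub_left s).mul_bdd hm hb
    have i2 : Integrable fun u : ℝ => g (s + u) * (k ε u : ℂ) :=
      (g.integrable.comp_add_left s).mul_bdd hm hb
    have e : ∫ u : ℝ, g (s + u) * (k ε u : ℂ) = -∫ u : ℝ, g (s - u) * (k ε u : ℂ) := by
      rw [← integral_neg_eq_self, ← integral_neg]
      congr 1 with u
      rw [hodd, sub_eq_add_neg]
      push_cast
      ring
    simp_rw [sub_mul]
    rw [integral_sub i1 i2, e]
    ring
  refine Tendsto.congr' (hpos.mono fun ε hε => (key ε hε).symm) (Tendsto.const_mul _ ?_)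
  refine tendsto_integral_filter_of_dominated_convergence _ (Eventually.of_forall fun ε => ?_)
    (hpos.mono fun ε hε => Eventually.of_forall fun u => ?_) (integrable_diff_div g s) ?_
  · exact ((by fun_prop : Continuous fun u => g (s - u) - g (s + u)).aestronglyMeasurable).mul
      (Complex.measurable_ofReal.comp (hmeas ε)).aestronglyMeasurable
  · rw [norm_mul, Complex.norm_real, Real.norm_eq_abs]
    gcongr
    exact hle ε hε u
  · filter_upwards [Measure.ae_ne volume (0 : ℝ)] with u hu
    exact ((Complex.continuous_ofReal.tendsto _).comp (hlim u hu)).const_mul _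

/-- The kernel `1 / u` cut off near the origin. -/
def truncKernel (ε u : ℝ) : ℝ := if ε < |u| then u⁻¹ else 0

/-- The conjugate Poisson kernel. -/
def conjPoisson (ε u : ℝ) : ℝ := u / (u ^ 2 + ε ^ 2)

lemma tendsto_truncKernel (g : 𝓢(ℝ, ℂ)) (s : ℝ) :
    Tendsto (fun ε => ∫ u : ℝ, g (s - u) * (truncKernel ε u : ℂ)) (𝓝[>] 0)
      (𝓝 (1 / 2 * ∫ u : ℝ, (g (s - u) - g (s + u)) * ((u⁻¹ : ℝ) : ℂ))) := by
  refine tendsto_integral_odd_kernel g s truncKernel (fun ε => ?_) (fun ε u => ?_)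
    (fun ε hε u => ?_) (fun ε hε => ⟨ε⁻¹, fun u => ?_⟩) (fun u hu => ?_)
  · exact Measurable.ite (measurableSet_lt measurable_const (by fun_prop)) (by fun_prop)
      measurable_const
  · simp only [truncKernel, abs_neg, inv_neg]
    split_ifs <;> simp
  · unfold truncKernel
    split_ifs
    · rw [abs_inv]
    · simp
  · unfold truncKernel
    split_ifs with h
    · rw [abs_inv]
      exact inv_anti₀ hε h.le
    · simpa using hε.le
  · refine tendsto_const_nhds.congr' ?_
    have : ∀ᶠ ε : ℝ in 𝓝[>] 0, ε < |u| :=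
      nhdsWithin_le_nhds (eventually_lt_nhds (abs_pos.mpr hu))
    exact this.mono fun ε h => by simp [truncKernel, h]

/-- The limit is the same as in `tendsto_truncKernel`, but this kernel is the Fourier transform of
an explicit integrable function, so the principal value can be computed through it. -/
lemma tendsto_conjPoisson (g : 𝓢(ℝ, ℂ)) (s : ℝ) :
    Tendsto (fun ε => ∫ u : ℝ, g (s - u) * (conjPoisson ε u : ℂ)) (𝓝[>] 0)
      (𝓝 (1 / 2 * ∫ u : ℝ, (g (s - u) - g (s + u)) * ((u⁻¹ : ℝ) : ℂ))) := by
  refine tendsto_integral_odd_kernel g s conjPoisson (fun ε => ?_) (fun ε u => ?_)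
    (fun ε hε u => ?_) (fun ε hε => ⟨ε⁻¹, fun u => ?_⟩) (fun u hu => ?_)
  · unfold conjPoisson; fun_prop
  · simp [conjPoisson, neg_div]
  · unfold conjPoisson
    rcases eq_or_ne u 0 with rfl | h0
    · simp
    · have := abs_pos.mpr h0
      rw [abs_div, abs_of_pos (by positivity : 0 < u ^ 2 + ε ^ 2), div_le_iff₀ (by positivity),
        ← sq_abs u, inv_mul_eq_div, le_div_iff₀ this]
      nlinarith
  · unfold conjPoisson
    rw [abs_div, abs_of_pos (by positivity : 0 < u ^ 2 + ε ^ 2), div_le_iff₀ (by positivity),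
      ← sq_abs u, inv_mul_eq_div, le_div_iff₀ hε]
    nlinarith [sq_nonneg (|u| - ε), abs_nonneg u]
  · have : Tendsto (fun ε : ℝ => conjPoisson ε u) (𝓝 0) (𝓝 (conjPoisson 0 u)) := by
      refine Continuous.tendsto' ?_ _ _ rfl
      unfold conjPoisson
      exact continuous_const.div (by fun_prop) fun ε => by positivity
    have e : conjPoisson 0 u = u⁻¹ := by
      unfold conjPoisson
      field_simp
      simp
    exact (e ▸ this).mono_left nhdsWithin_le_nhds

/-- The sign function, with value `-1` at the origin. -/
def sgn (σ : ℝ) : ℂ := if 0 < σ then 1 else -1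

lemma measurable_sgn : Measurable sgn :=
  Measurable.ite measurableSet_Ioi measurable_const measurable_const

lemma norm_sgn (σ : ℝ) : ‖sgn σ‖ = 1 := by
  unfold sgn; split_ifs <;> simp

lemma sgn_mul_self (σ : ℝ) : sgn σ * σ = |σ| := by
  unfold sgn
  split_ifs with h
  · simp [abs_of_pos h]
  · simp [abs_of_nonpos (not_lt.mp h)]

/-- The Fourier transform of `i sgn σ e^{-2πε|σ|}` is the conjugate Poisson kernel. -/
lemma fourier_sgn_mul_exp (ε : ℝ) (hε : 0 < ε) (u : ℝ) :
    Integrable (fun σ : ℝ => Complex.I * sgn σ * Real.exp (-(2 * Real.pi * ε) * |σ|)) ∧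
    𝓕 (fun σ : ℝ => Complex.I * sgn σ * Real.exp (-(2 * Real.pi * ε) * |σ|)) u =
      1 / Real.pi * conjPoisson ε u := by
  -- The two half-lines contribute the exponentials `e^{-aσ}` and `e^{bσ}`, and `a * b = 4π²(u² +
  -- ε²)` yields the denominator.
  set a : ℂ := 2 * Real.pi * (ε + u * Complex.I) with ha
  set b : ℂ := 2 * Real.pi * (ε - u * Complex.I) with hb
  have hra : (-a).re < 0 := by
    simp [ha, Real.pi_pos, hε]
  have hrb : 0 < b.re := by
    simp [hb, Real.pi_pos, hε]
  have e1 : ∀ σ ∈ Set.Ioi (0 : ℝ), Real.fourierChar (-(σ * u)) •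
      (Complex.I * sgn σ * Real.exp (-(2 * Real.pi * ε) * |σ|)) =
      Complex.I * Complex.exp (-a * σ) := by
    intro σ hσ
    have hσ' : 0 < σ := hσ
    rw [sgn, if_pos hσ', abs_of_pos hσ', Circle.smul_def, Real.fourierChar_apply, smul_eq_mul,
      Complex.ofReal_exp, mul_one, mul_left_comm, ← Complex.exp_add]
    congr 2
    push_cast [ha]
    ring
  have e2 : ∀ σ ∈ Set.Iic (0 : ℝ), Real.fourierChar (-(σ * u)) •
      (Complex.I * sgn σ * Real.exp (-(2 * Real.pi * ε) * |σ|)) =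
      -Complex.I * Complex.exp (b * σ) := by
    intro σ hσ
    have hσ' : σ ≤ 0 := hσ
    rw [sgn, if_neg (not_lt.mpr hσ'), abs_of_nonpos hσ', Circle.smul_def, Real.fourierChar_apply,
      smul_eq_mul, Complex.ofReal_exp, mul_neg_one, mul_left_comm, ← Complex.exp_add]
    congr 2
    push_cast [hb]
    ring
  have i1 : IntegrableOn (fun σ : ℝ => Real.fourierChar (-(σ * u)) •
      (Complex.I * sgn σ * Real.exp (-(2 * Real.pi * ε) * |σ|))) (Set.Ioi 0) :=
    IntegrableOn.congr_fun ((integrableOn_exp_mul_complex_Ioi hra 0).const_mul Complex.I)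
      (fun σ hσ => (e1 σ hσ).symm) measurableSet_Ioi
  have i2 : IntegrableOn (fun σ : ℝ => Real.fourierChar (-(σ * u)) •
      (Complex.I * sgn σ * Real.exp (-(2 * Real.pi * ε) * |σ|))) (Set.Iic 0) :=
    IntegrableOn.congr_fun ((integrableOn_exp_mul_complex_Iic hrb 0).const_mul (-Complex.I))
      (fun σ hσ => (e2 σ hσ).symm) measurableSet_Iic
  have i3 := i2.union i1
  rw [Set.Iic_union_Ioi, integrableOn_univ] at i3
  refine ⟨?_, ?_⟩
  · refine (Real.fourierIntegral_convergent_iff (μ := volume) u).mp ?_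
    convert! i3 using 4
    simp [mul_comm]
  · rw [Real.fourier_real_eq, ← intervalIntegral.integral_Iic_add_Ioi i2 i1,
      setIntegral_congr_fun measurableSet_Iic e2, setIntegral_congr_fun measurableSet_Ioi e1,
      integral_const_mul, integral_const_mul, integral_exp_mul_complex_Ioi hra,
      integral_exp_mul_complex_Iic hrb]
    have hpi : (Real.pi : ℂ) ≠ 0 := by exact_mod_cast Real.pi_ne_zero
    have ha0 : a ≠ 0 := fun h => by simp [h] at hra
    have hb0 : b ≠ 0 := fun h => by simp [h] at hrb
    have hab : a * b = 4 * Real.pi ^ 2 * (u ^ 2 + ε ^ 2) := by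
      rw [ha, hb]
      linear_combination (-4 * (Real.pi : ℂ) ^ 2 * u ^ 2) * Complex.I_sq
    have hq : ((u : ℂ) ^ 2 + ε ^ 2) ≠ 0 := by
      have : u ^ 2 + ε ^ 2 ≠ 0 := by positivity
      exact_mod_cast this
    have hlhs : -Complex.I * (Complex.exp (b * (0 : ℝ)) / b) +
        Complex.I * (-Complex.exp (-a * (0 : ℝ)) / -a) = Complex.I * (b - a) / (a * b) := by
      simp only [Complex.ofReal_zero, mul_zero, Complex.exp_zero]
      field_simp
      ring
    rw [hlhs, hab, conjPoisson]
    push_cast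
    rw [div_mul_div_comm, div_eq_div_iff (by simp [hpi, hq]) (by simp [hpi, hq]), ha, hb]
    linear_combination (-4 * (Real.pi : ℂ) ^ 2 * u * (u ^ 2 + ε ^ 2)) * Complex.I_sq

/-- This is the multiplication formula `∫ f̂ g = ∫ f ĝ`, with `f` the damped sign and `g` the
function `u ↦ 𝓕⁻ G (s - u)`. -/
lemma integral_conjPoisson (G : 𝓢(ℝ, ℂ)) (s ε : ℝ) (hε : 0 < ε) :
    1 / (Real.pi : ℂ) * ∫ u : ℝ, 𝓕⁻ G (s - u) * (conjPoisson ε u : ℂ) =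
      ∫ σ : ℝ, Real.fourierChar (-(σ * s)) •
        (Complex.I * sgn σ * Real.exp (-(2 * Real.pi * ε) * |σ|) * G (-σ)) := by
  have hF : ∀ σ : ℝ, 𝓕 (fun u : ℝ => 𝓕⁻ G (s - u)) σ =
      Real.fourierChar (-(σ * s)) • G (-σ) := by
    intro σ
    have h : G (-σ) = ∫ t : ℝ, Real.fourierChar (-(t * -σ)) • 𝓕⁻ G t := by
      rw [← Real.fourier_real_eq, ← SchwartzMap.fourier_coe, FourierTransform.fourier_fourierInv_eq]
    rw [Real.fourier_real_eq, ← integral_sub_left_eq_self _ volume s, h,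
      Circle.smul_def (Real.fourierChar (-(σ * s))),
      ← integral_smul]
    congr 1 with t
    rw [sub_sub_cancel, ← Circle.smul_def, smul_smul, ← AddChar.map_add_eq_mul]
    congr 2
    ring
  have hflip := VectorFourier.integral_fourierIntegral_smul_eq_flip (L := innerₗ ℝ)
    (μ := volume) (ν := volume) Real.continuous_fourierChar continuous_inner
    (fourier_sgn_mul_exp ε hε 0).1 ((𝓕⁻ G).integrable.comp_sub_left s)
  rw [flip_innerₗ] at hflip
  change ∫ ξ : ℝ, 𝓕 (fun σ : ℝ => Complex.I * sgn σ * Real.exp (-(2 * Real.pi * ε) * |σ|)) ξ •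
    𝓕⁻ G (s - ξ) = ∫ σ : ℝ, (Complex.I * sgn σ * Real.exp (-(2 * Real.pi * ε) * |σ|)) •
    𝓕 (fun u : ℝ => 𝓕⁻ G (s - u)) σ at hflip
  simp_rw [hF, (fourier_sgn_mul_exp ε hε _).2] at hflip
  rw [← integral_const_mul]
  convert hflip using 1
  · congr 1 with u
    rw [smul_eq_mul]
    ring
  · congr 1 with σ
    rw [smul_comm, smul_eq_mul]

/-- The Hilbert transform is the Fourier multiplier `-i sgn`. -/
lemma hilbert_fourierInv (G : 𝓢(ℝ, ℂ)) :
    hilbert (𝓕⁻ G : 𝓢(ℝ, ℂ)) = 𝓕 (fun σ : ℝ => Complex.I * sgn σ * G (-σ)) := by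
  funext s
  refine Tendsto.limUnder_eq ?_
  -- The truncated and the conjugate Poisson integrals share a limit; for the latter, dominated
  -- convergence on the Fourier side removes the damping.
  have h1 := (tendsto_truncKernel (𝓕⁻ G) s).const_mul (1 / (Real.pi : ℂ))
  have h2 := (tendsto_conjPoisson (𝓕⁻ G) s).const_mul (1 / (Real.pi : ℂ))
  have hpos : ∀ᶠ ε : ℝ in 𝓝[>] 0, 0 < ε := eventually_mem_nhdsWithin
  have h3 : Tendsto (fun ε => ∫ σ : ℝ, Real.fourierChar (-(σ * s)) •
        (Complex.I * sgn σ * Real.exp (-(2 * Real.pi * ε) * |σ|) * G (-σ))) (𝓝[>] 0)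
      (𝓝 (𝓕 (fun σ : ℝ => Complex.I * sgn σ * G (-σ)) s)) := by
    rw [Real.fourier_real_eq]
    refine tendsto_integral_filter_of_dominated_convergence (fun σ => ‖G (-σ)‖)
      (Eventually.of_forall fun ε => ?_) (hpos.mono fun ε hε => Eventually.of_forall fun σ => ?_)
      G.integrable.comp_neg.norm (Eventually.of_forall fun σ => ?_)
    · have := measurable_sgn
      refine Measurable.aestronglyMeasurable ?_
      simp only [Circle.smul_def]
      fun_prop
    · rw [Circle.norm_smul, norm_mul, norm_mul, norm_mul, norm_sgn, Complex.norm_I, one_mul,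
        one_mul, Complex.norm_real, Real.norm_eq_abs, Real.abs_exp]
      refine mul_le_of_le_one_left (norm_nonneg _) (Real.exp_le_one_iff.mpr ?_)
      have := Real.pi_pos
      rw [neg_mul]
      exact neg_nonpos.mpr (by positivity)
    · refine Tendsto.mono_left ?_ nhdsWithin_le_nhds
      refine Continuous.tendsto' ?_ _ _ (by simp)
      simp only [Circle.smul_def]
      fun_prop
  have h4 := tendsto_nhds_unique
    (h2.congr' (hpos.mono fun ε hε => integral_conjPoisson G s ε hε)) h3
  rw [← h4]
  refine h1.congr fun ε => ?_
  congr 1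
  rw [← integral_indicator (measurableSet_lt measurable_const (by fun_prop)),
    ← integral_sub_left_eq_self _ volume s]
  congr 1 with u
  by_cases hu : ε < |s - u| <;> simp [Set.indicator, truncKernel, hu, div_eq_mul_inv]

/-! ### Normalizing constants: both parities give the multiplier `|σ|^(n-1) / 2`. -/

lemma integrable_pow_mul_comp_neg (G : 𝓢(ℝ, ℂ)) {m : ℝ → ℂ} (hm : Measurable m)
    (hm1 : ∀ σ, ‖m σ‖ ≤ 1) (k : ℕ) : Integrable fun σ : ℝ => σ ^ k • (m σ * G (-σ)) := by
  refine (G.integrable_pow_mul volume k).comp_neg.mono' (by fun_prop)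
    (Eventually.of_forall fun σ => ?_)
  rw [norm_smul, norm_mul, norm_pow, norm_neg]
  gcongr
  exact mul_le_of_le_one_left (norm_nonneg _) (hm1 σ)

/-- With `m` involving `sgn` the product need not be Schwartz, but its moments are integrable, which
suffices for differentiating the Fourier integral. -/
lemma iteratedDeriv_fourier_mul (G : 𝓢(ℝ, ℂ)) {m : ℝ → ℂ} (hm : Measurable m)
    (hm1 : ∀ σ, ‖m σ‖ ≤ 1) (k : ℕ) :
    iteratedDeriv k (𝓕 fun σ : ℝ => m σ * G (-σ)) =
      𝓕 fun σ : ℝ => (-2 * Real.pi * Complex.I * σ) ^ k • (m σ * G (-σ)) :=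
  Real.iteratedDeriv_fourier (N := k) (fun j _ => integrable_pow_mul_comp_neg G hm hm1 j) le_rfl

lemma fourier_const_mul (c : ℂ) (f : ℝ → ℂ) (s : ℝ) :
    c * 𝓕 f s = 𝓕 (fun σ => c * f σ) s := by
  rw [Real.fourier_real_eq, Real.fourier_real_eq, ← integral_const_mul]
  congr 1 with σ
  simp only [Circle.smul_def, smul_eq_mul]
  ring

lemma abs_pow_eq_sgn_mul_pow {k : ℕ} (hk : Odd k) (σ : ℝ) :
    ((|σ| : ℝ) : ℂ) ^ k = sgn σ * (σ : ℂ) ^ k := by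
  obtain ⟨m, rfl⟩ := hk
  rw [← sgn_mul_self, mul_pow, pow_succ, pow_mul (sgn σ)]
  have : sgn σ ^ 2 = 1 := by unfold sgn; split_ifs <;> norm_num
  rw [this, one_pow, one_mul]

/-- With `n - 1 = 2m`, the factor `(-2πiσ)^(2m)` is `(-1)^m (2π)^(2m) |σ|^(2m)`, and the prefactor
cancels the sign and the power of `2π`. -/
lemma odd_normalization (hn : Odd n) (G : 𝓢(ℝ, ℂ)) (s : ℝ) :
    (-1) ^ ((n - 1) / 2) / (2 * (2 * (Real.pi : ℂ)) ^ (n - 1)) *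
      ((-1) ^ (n - 1) * iteratedDeriv (n - 1) (𝓕⁻ G : 𝓢(ℝ, ℂ)) s) =
      𝓕 (fun σ : ℝ => 1 / 2 * ((|σ| : ℝ) : ℂ) ^ (n - 1) * G (-σ)) s := by
  have hg : ⇑(𝓕⁻ G : 𝓢(ℝ, ℂ)) = 𝓕 fun σ : ℝ => 1 * G (-σ) := by
    rw [SchwartzMap.fourierInv_coe, Real.fourierInv_eq_fourier_comp_neg]
    simp only [one_mul]
  rw [hg, iteratedDeriv_fourier_mul G measurable_const (by simp), ← mul_assoc, fourier_const_mul]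
  refine congrFun (congrArg _ (funext fun σ => ?_)) s
  obtain ⟨m, rfl⟩ := hn
  have hpi : (Real.pi : ℂ) ≠ 0 := by exact_mod_cast Real.pi_ne_zero
  have h1 : ((|σ| : ℝ) : ℂ) ^ (2 * m) = (σ : ℂ) ^ (2 * m) := by
    rw [pow_mul, pow_mul, ← Complex.ofReal_pow, sq_abs, Complex.ofReal_pow]
  have h2 : (-2 * Real.pi * Complex.I * σ) ^ (2 * m) =
      (2 * (Real.pi : ℂ)) ^ (2 * m) * (-1) ^ m * (σ : ℂ) ^ (2 * m) := by
    rw [mul_pow, mul_pow (-2 * (Real.pi : ℂ)), pow_mul Complex.I, Complex.I_sq, neg_mul,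
      Even.neg_pow (even_two_mul m)]
  have h3 : ((-1 : ℂ) ^ m) * (-1) ^ m = 1 := by rw [← mul_pow]; simp
  have hne : (2 * (Real.pi : ℂ)) ^ (2 * m) ≠ 0 := pow_ne_zero _ (mul_ne_zero two_ne_zero hpi)
  simp only [Nat.add_sub_cancel, Nat.mul_div_cancel_left m two_pos, smul_eq_mul]
  rw [h1, h2, Even.neg_one_pow (even_two_mul m)]
  field_simp
  linear_combination ((σ : ℂ) ^ (2 * m) * G (-σ)) * h3

/-- Now `n - 1` is odd: the factor `i sgn σ` of the Hilbert transform absorbs the leftover `i` and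
turns `σ^(n-1)` into `|σ|^(n-1)`. The minus sign from transposing `H` cancels `(-1)^(n-1)`. -/
lemma even_normalization (hn : 2 ≤ n) (he : Even n) (G : 𝓢(ℝ, ℂ)) (s : ℝ) :
    (-1) ^ ((n - 2) / 2) / (2 * (2 * (Real.pi : ℂ)) ^ (n - 1)) *
      (-((-1) ^ (n - 1) * iteratedDeriv (n - 1) (hilbert (𝓕⁻ G : 𝓢(ℝ, ℂ))) s)) =
      𝓕 (fun σ : ℝ => 1 / 2 * ((|σ| : ℝ) : ℂ) ^ (n - 1) * G (-σ)) s := by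
  have hm : Measurable fun σ => Complex.I * sgn σ := measurable_const.mul measurable_sgn
  rw [hilbert_fourierInv, iteratedDeriv_fourier_mul G hm (fun σ => by simp [norm_sgn]),
    ← neg_mul, ← mul_assoc, fourier_const_mul]
  refine congrFun (congrArg _ (funext fun σ => ?_)) s
  obtain ⟨m, rfl⟩ : ∃ m, n = 2 * m + 2 := by
    obtain ⟨j, hj⟩ := he
    exact ⟨j - 1, by omega⟩
  have hpi : (Real.pi : ℂ) ≠ 0 := by exact_mod_cast Real.pi_ne_zero
  have h2 : (-2 * Real.pi * Complex.I * σ) ^ (2 * m + 1) =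
      -((2 * (Real.pi : ℂ)) ^ (2 * m + 1) * ((-1) ^ m * Complex.I) * (σ : ℂ) ^ (2 * m + 1)) := by
    rw [mul_pow, mul_pow (-2 * (Real.pi : ℂ)), pow_succ Complex.I, pow_mul Complex.I, Complex.I_sq,
      neg_mul, Odd.neg_pow (odd_two_mul_add_one m)]
    ring
  have h3 : ((-1 : ℂ) ^ m) * (-1) ^ m = 1 := by rw [← mul_pow]; simp
  have hne : (2 * (Real.pi : ℂ)) ^ (2 * m + 1) ≠ 0 :=
    pow_ne_zero _ (mul_ne_zero two_ne_zero hpi)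
  simp only [Nat.add_sub_cancel, Nat.mul_div_cancel_left m two_pos, smul_eq_mul,
    show 2 * m + 2 - 1 = 2 * m + 1 by omega]
  rw [abs_pow_eq_sgn_mul_pow (odd_two_mul_add_one m), h2,
    Odd.neg_one_pow (odd_two_mul_add_one m)]
  field_simp
  linear_combination (-((-1 : ℂ) ^ m) * (-1) ^ m * sgn σ * (σ : ℂ) ^ (2 * m + 1) * G (-σ)) *
    Complex.I_sq + (sgn σ * (σ : ℂ) ^ (2 * m + 1) * G (-σ)) * h3

/-! ### The filtered Radon transform and duality with back-projection. -/

/-- The integrand of the filtered Radon transform on the Fourier side. -/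
def filteredSlice (φ : 𝓢(EuclideanSpace ℝ (Fin n), ℂ)) (θ : Sph n) (σ : ℝ) : ℂ :=
  1 / 2 * ((|σ| : ℝ) : ℂ) ^ (n - 1) * slice φ θ (-σ)

/-- The Radon transform of `φ` filtered by the multiplier `|σ|^{n-1} / 2`. -/
def filtered (φ : 𝓢(EuclideanSpace ℝ (Fin n), ℂ)) (θ : Sph n) (s : ℝ) : ℂ :=
  𝓕 (filteredSlice φ θ) s

lemma continuous_filteredSlice (φ : 𝓢(EuclideanSpace ℝ (Fin n), ℂ)) :
    Continuous fun p : Sph n × ℝ => filteredSlice φ p.1 p.2 := by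
  unfold filteredSlice
  simp only [slice_apply]
  fun_prop

/-- As `|σθ| = |σ|`, the decay of `𝓕 φ` with weights of degree `n - 1` and `n + 1` gives a bound
uniform in `θ`, needed for joint continuity of `filtered`. -/
lemma exists_norm_filteredSlice_le (φ : 𝓢(EuclideanSpace ℝ (Fin n), ℂ)) :
    ∃ C : ℝ, ∀ θ σ, ‖filteredSlice φ θ σ‖ ≤ C * (1 + σ ^ 2)⁻¹ := by
  obtain ⟨C₁, -, h₁⟩ := (𝓕 φ).decay (n - 1) 0
  obtain ⟨C₂, -, h₂⟩ := (𝓕 φ).decay (n - 1 + 2) 0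
  refine ⟨C₁ + C₂, fun θ σ => ?_⟩
  have e1 := h₁ (-σ • (θ : EuclideanSpace ℝ (Fin n)))
  have e2 := h₂ (-σ • (θ : EuclideanSpace ℝ (Fin n)))
  have hθ : ‖-σ • (θ : EuclideanSpace ℝ (Fin n))‖ = |σ| := by simp [norm_smul]
  rw [norm_iteratedFDeriv_zero, hθ] at e1 e2
  rw [pow_add, sq_abs] at e2
  rw [← div_eq_mul_inv, le_div_iff₀ (by positivity)]
  have hle : ‖filteredSlice φ θ σ‖ ≤
      |σ| ^ (n - 1) * ‖𝓕 φ (-σ • (θ : EuclideanSpace ℝ (Fin n)))‖ := by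
    rw [filteredSlice, slice_apply, norm_mul, norm_mul, norm_pow, Complex.norm_real,
      norm_abs_eq_norm,
      Real.norm_eq_abs, mul_assoc]
    refine mul_le_of_le_one_left (by positivity) ?_
    norm_num
  calc ‖filteredSlice φ θ σ‖ * (1 + σ ^ 2) ≤
      (|σ| ^ (n - 1) * ‖𝓕 φ (-σ • (θ : EuclideanSpace ℝ (Fin n)))‖) * (1 + σ ^ 2) := by gcongr
    _ ≤ C₁ + C₂ := by linarith

lemma integrable_filteredSlice (φ : 𝓢(EuclideanSpace ℝ (Fin n), ℂ)) (θ : Sph n) :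
    Integrable (filteredSlice φ θ) := by
  obtain ⟨C, hC⟩ := exists_norm_filteredSlice_le φ
  exact (integrable_inv_one_add_sq.const_mul C).mono'
    ((continuous_filteredSlice φ).comp (Continuous.prodMk_right θ)).aestronglyMeasurable
    (Eventually.of_forall (hC θ))

lemma continuous_filtered (φ : 𝓢(EuclideanSpace ℝ (Fin n), ℂ)) :
    Continuous fun p : Sph n × ℝ => filtered φ p.1 p.2 := by
  obtain ⟨C, hC⟩ := exists_norm_filteredSlice_le φ
  have hc := continuous_filteredSlice φ
  simp only [filtered, Real.fourier_real_eq, Circle.smul_def, smul_eq_mul]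
  have hF : Continuous fun q : (Sph n × ℝ) × ℝ =>
      (Real.fourierChar (-(q.2 * q.1.2)) : ℂ) * filteredSlice φ q.1.1 q.2 := by
    have := hc.comp ((continuous_fst.comp continuous_fst).prodMk continuous_snd :
      Continuous fun q : (Sph n × ℝ) × ℝ => (q.1.1, q.2))
    exact Continuous.mul (by fun_prop) this
  refine continuous_of_dominated (bound := fun σ => C * (1 + σ ^ 2)⁻¹) (fun p => ?_)
    (fun p => Eventually.of_forall fun σ => ?_)
    (integrable_inv_one_add_sq.const_mul C) (Eventually.of_forall fun σ => ?_)
  · exact (hF.comp (Continuous.prodMk_right p)).aestronglyMeasurable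
  · rw [norm_mul, Circle.norm_coe, one_mul]
    exact hC p.1 σ
  · exact hF.comp (Continuous.prodMk_left σ)

lemma changNumerator_eq_integral (hn : 2 ≤ n) (W : EuclideanSpace ℝ (Fin n) × Sph n → ℂ)
    (f : EuclideanSpace ℝ (Fin n) → ℂ) (φ : 𝓢(EuclideanSpace ℝ (Fin n), ℂ))
    (hφ : HasCompactSupport φ) :
    changNumerator W f φ =
      ∫ θ, (∫ s, weightedRadon W f s θ * filtered φ θ s) ∂(sphereMeasure n) := by
  unfold changNumerator
  split_ifs with he
  · rw [← integral_const_mul]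
    congr 1 with θ
    simp only [ridge, distHilbert, radonDeriv, distDeriv, ofFun]
    rw [hyperplaneIntegral_eq_fourierInv φ hφ θ, ← neg_mul, ← mul_assoc, ← integral_const_mul]
    congr 1 with s
    rw [filtered]
    unfold filteredSlice
    rw [← even_normalization hn he]
    ring
  · rw [← integral_const_mul]
    congr 1 with θ
    simp only [ridge, radonDeriv, distDeriv, ofFun]
    rw [hyperplaneIntegral_eq_fourierInv φ hφ θ, ← mul_assoc, ← integral_const_mul]
    congr 1 with s
    rw [filtered]
    unfold filteredSlice
    rw [← odd_normalization (Nat.not_even_iff_odd.mp he)]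
    ring

/-- The weighted back-projection of the filtered Radon transform of `φ`. -/
def backproj (W : EuclideanSpace ℝ (Fin n) × Sph n → ℂ) (φ : 𝓢(EuclideanSpace ℝ (Fin n), ℂ))
    (x : EuclideanSpace ℝ (Fin n)) : ℂ :=
  ∫ θ, W (x, θ) * filtered φ θ ⟪x, (θ : EuclideanSpace ℝ (Fin n))⟫ ∂(sphereMeasure n)

instance : IsFiniteMeasure (sphereMeasure n) := by
  unfold sphereMeasure; infer_instance

lemma continuous_mul_filtered {W : EuclideanSpace ℝ (Fin n) × Sph n → ℂ} (hW : Continuous W)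
    (φ : 𝓢(EuclideanSpace ℝ (Fin n), ℂ)) :
    Continuous fun p : EuclideanSpace ℝ (Fin n) × Sph n =>
      W p * filtered φ p.2 ⟪p.1, (p.2 : EuclideanSpace ℝ (Fin n))⟫ := by
  have h : Continuous fun p : EuclideanSpace ℝ (Fin n) × Sph n =>
      (p.2, ⟪p.1, (p.2 : EuclideanSpace ℝ (Fin n))⟫) :=
    continuous_snd.prodMk (continuous_fst.inner (continuous_subtype_val.comp continuous_snd))
  have h2 : Continuous fun p : EuclideanSpace ℝ (Fin n) × Sph n =>
      filtered φ p.2 ⟪p.1, (p.2 : EuclideanSpace ℝ (Fin n))⟫ :=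
    Continuous.comp (g := fun q : Sph n × ℝ => filtered φ q.1 q.2)
      (f := fun p : EuclideanSpace ℝ (Fin n) × Sph n =>
        (p.2, ⟪p.1, (p.2 : EuclideanSpace ℝ (Fin n))⟫)) (continuous_filtered φ) h
  exact Continuous.mul hW h2

lemma continuous_sphere_integral {F : EuclideanSpace ℝ (Fin n) × Sph n → ℂ} (hF : Continuous F) :
    Continuous fun x => ∫ θ, F (x, θ) ∂(sphereMeasure n) := by
  have := continuous_parametric_integral_of_continuous (μ := sphereMeasure n)
    (f := fun x θ => F (x, θ)) hF isCompact_univ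
  simpa using this

lemma continuous_backproj {W : EuclideanSpace ℝ (Fin n) × Sph n → ℂ} (hW : Continuous W)
    (φ : 𝓢(EuclideanSpace ℝ (Fin n), ℂ)) : Continuous (backproj W φ) :=
  continuous_sphere_integral (continuous_mul_filtered hW φ)

/-- For fixed `θ`, Fubini over the hyperplanes `x·θ = s` gives an integral over `ℝⁿ`; then `x` and
`θ` are swapped, as the integrand is continuous with compact support. -/
lemma changNumerator_eq_integral_backproj (hn : 2 ≤ n)
    {W : EuclideanSpace ℝ (Fin n) × Sph n → ℂ} (hW : Continuous W)
    {f : EuclideanSpace ℝ (Fin n) → ℂ} (hf : Continuous f) (hfs : HasCompactSupport f)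
    (φ : 𝓢(EuclideanSpace ℝ (Fin n), ℂ)) (hφ : HasCompactSupport φ) :
    changNumerator W f φ = ∫ x, f x * backproj W φ x := by
  rw [changNumerator_eq_integral hn W f φ hφ]
  have hc : Continuous fun p : EuclideanSpace ℝ (Fin n) × Sph n =>
      f p.1 * (W p * filtered φ p.2 ⟪p.1, (p.2 : EuclideanSpace ℝ (Fin n))⟫) :=
    (hf.comp continuous_fst).mul (continuous_mul_filtered hW φ)
  have h1 : ∀ θ : Sph n, ∫ s, weightedRadon W f s θ * filtered φ θ s =
      ∫ x, f x * (W (x, θ) * filtered φ θ ⟪x, (θ : EuclideanSpace ℝ (Fin n))⟫) := by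
    intro θ
    have hθ : Continuous fun x : EuclideanSpace ℝ (Fin n) =>
        f x * (W (x, θ) * filtered φ θ ⟪x, (θ : EuclideanSpace ℝ (Fin n))⟫) :=
      hc.comp (Continuous.prodMk_left θ)
    have hi := hθ.integrable_of_hasCompactSupport (μ := volume) hfs.mul_right
    have e : ∀ x : EuclideanSpace ℝ (Fin n),
        f x * (W (x, θ) * filtered φ θ ⟪x, (θ : EuclideanSpace ℝ (Fin n))⟫) =
        W (x, θ) * f x * filtered φ θ ⟪x, (θ : EuclideanSpace ℝ (Fin n))⟫ := fun x => by ring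
    simp only [e] at hi ⊢
    exact integral_hyperplaneIntegral_mul hi
  simp_rw [h1]
  rw [integral_integral_swap_of_hasCompactSupport]
  · simp_rw [integral_const_mul]
    rfl
  · exact hc.comp continuous_swap
  · refine HasCompactSupport.intro (isCompact_univ.prod hfs.isCompact) fun p hp => ?_
    have : p.2 ∉ tsupport f := fun h => hp ⟨Set.mem_univ _, h⟩
    simp [Function.uncurry, image_eq_zero_of_notMem_tsupport this]

/-! ### Polar coordinates and the symbol of the back-projection. -/

/-- Integration in polar coordinates. -/
lemma integral_polar [Nontrivial (EuclideanSpace ℝ (Fin n))]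
    {F : EuclideanSpace ℝ (Fin n) → ℂ} (hF : Integrable F) :
    ∫ x, F x = ∫ θ : Sph n, (∫ r in Set.Ioi (0 : ℝ),
      ((r ^ (n - 1) : ℝ) : ℂ) * F (r • (θ : EuclideanSpace ℝ (Fin n)))) ∂(sphereMeasure n) := by
  have hmp :=
    (volume : Measure (EuclideanSpace ℝ (Fin n))).measurePreserving_homeomorphUnitSphereProd
  have hemb := (homeomorphUnitSphereProd (EuclideanSpace ℝ (Fin n))).measurableEmbedding
  have h0 : ∫ x, F x = ∫ x : ({(0)}ᶜ : Set (EuclideanSpace ℝ (Fin n))), F x.1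
      ∂((volume : Measure (EuclideanSpace ℝ (Fin n))).comap (↑)) := by
    rw [integral_subtype_comap (measurableSet_singleton _).compl F,
      restrict_compl_singleton]
  have hi0 : Integrable (fun x : ({(0)}ᶜ : Set (EuclideanSpace ℝ (Fin n))) => F x.1)
      ((volume : Measure (EuclideanSpace ℝ (Fin n))).comap (↑)) := by
    have := (integrableOn_iff_comap_subtypeVal
      (μ := (volume : Measure (EuclideanSpace ℝ (Fin n)))) (f := F)
      (measurableSet_singleton (0 : EuclideanSpace ℝ (Fin n))).compl).mp hF.integrableOn
    exact this
  have hcomp : (fun x : ({(0)}ᶜ : Set (EuclideanSpace ℝ (Fin n))) => F x.1) =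
      (fun p : Sph n × Set.Ioi (0 : ℝ) => F (p.2.1 • p.1.1)) ∘
        homeomorphUnitSphereProd (EuclideanSpace ℝ (Fin n)) := by
    funext x
    have := congrArg Subtype.val
      ((homeomorphUnitSphereProd (EuclideanSpace ℝ (Fin n))).symm_apply_apply x)
    rw [homeomorphUnitSphereProd_symm_apply_coe] at this
    simp only [Function.comp_apply]
    rw [this]
  rw [h0]
  rw [hcomp] at hi0 ⊢
  rw [hmp.integrable_comp_emb hemb] at hi0
  have h1 := hmp.integral_comp hemb
    (fun p : Sph n × Set.Ioi (0 : ℝ) => F (p.2.1 • p.1.1))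
  simp only [Function.comp_def] at h1 ⊢
  rw [h1, integral_prod _ hi0]
  unfold sphereMeasure
  congr 1 with θ
  simp only [Measure.volumeIoiPow, ENNReal.ofReal]
  rw [integral_withDensity_eq_integral_smul, finrank_euclideanSpace_fin,
    integral_subtype_comap measurableSet_Ioi
      fun a : ℝ => Real.toNNReal (a ^ (n - 1)) • F (a • (θ : EuclideanSpace ℝ (Fin n)))]
  · refine setIntegral_congr_fun measurableSet_Ioi fun r hr => ?_
    rw [NNReal.smul_def, Real.coe_toNNReal _ (pow_nonneg (le_of_lt hr) _), Complex.real_smul]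
  · exact (measurable_subtype_coe.pow_const _).real_toNNReal

/-- The direction `ξ / |ξ|` of a nonzero vector. -/
def direction (θ₀ : Sph n) (ξ : EuclideanSpace ℝ (Fin n)) : Sph n :=
  if h : ξ = 0 then θ₀ else ⟨‖ξ‖⁻¹ • ξ, by simp [norm_smul, h]⟩

lemma direction_coe (θ₀ : Sph n) {ξ : EuclideanSpace ℝ (Fin n)} (h : ξ ≠ 0) :
    (direction θ₀ ξ : EuclideanSpace ℝ (Fin n)) = ‖ξ‖⁻¹ • ξ := by
  rw [direction, dif_neg h]

lemma direction_pos_smul (θ₀ : Sph n) {r : ℝ} (hr : 0 < r) (ξ : EuclideanSpace ℝ (Fin n)) :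
    direction θ₀ (r • ξ) = direction θ₀ ξ := by
  rcases eq_or_ne ξ 0 with rfl | h
  · rw [smul_zero]
  · refine Subtype.ext ?_
    rw [direction_coe θ₀ h, direction_coe θ₀ (smul_ne_zero hr.ne' h), norm_smul, smul_smul,
      Real.norm_of_nonneg hr.le, mul_inv_rev, mul_assoc, inv_mul_cancel₀ hr.ne', mul_one]

lemma direction_self (θ₀ θ : Sph n) : direction θ₀ (θ : EuclideanSpace ℝ (Fin n)) = θ := by
  refine Subtype.ext ?_
  rw [direction_coe θ₀ (ne_zero_of_mem_unit_sphere θ), norm_eq_of_mem_sphere, inv_one, one_smul]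

lemma direction_neg (θ₀ : Sph n) {ξ : EuclideanSpace ℝ (Fin n)} (h : ξ ≠ 0) :
    direction θ₀ (-ξ) = -direction θ₀ ξ := by
  refine Subtype.ext ?_
  rw [direction_coe θ₀ (neg_ne_zero.mpr h), norm_neg, smul_neg]
  exact congrArg _ (direction_coe θ₀ h).symm

lemma continuousAt_direction (θ₀ : Sph n) {ξ : EuclideanSpace ℝ (Fin n)} (h : ξ ≠ 0) :
    ContinuousAt (direction θ₀) ξ := by
  rw [IsInducing.subtypeVal.continuousAt_iff]
  have : ContinuousAt (fun η : EuclideanSpace ℝ (Fin n) => ‖η‖⁻¹ • η) ξ :=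
    (continuousAt_id.norm.inv₀ (norm_ne_zero_iff.mpr h)).smul continuousAt_id
  refine this.congr ?_
  filter_upwards [isOpen_ne.mem_nhds h] with η hη
  exact (direction_coe θ₀ hη).symm

lemma measurable_direction (θ₀ : Sph n) : Measurable (direction θ₀) :=
  measurable_of_continuousOn_compl_singleton 0 fun _ hξ =>
    (continuousAt_direction θ₀ hξ).continuousWithinAt

/-- The even part in the direction `ξ / |ξ|` of a weight on the sphere. -/
def evenSymbol (V : Sph n → ℂ) (θ₀ : Sph n) (ξ : EuclideanSpace ℝ (Fin n)) : ℂ :=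
  (V (direction θ₀ ξ) + V (direction θ₀ (-ξ))) / 2

lemma measurable_evenSymbol {V : Sph n → ℂ} (hV : Continuous V) (θ₀ : Sph n) :
    Measurable (evenSymbol V θ₀) := by
  have h := hV.measurable.comp (measurable_direction θ₀)
  exact (h.add (h.comp measurable_neg)).div_const 2

lemma norm_evenSymbol_le {V : Sph n → ℂ} {C : ℝ} (hC : ∀ θ, ‖V θ‖ ≤ C) (θ₀ : Sph n)
    (ξ : EuclideanSpace ℝ (Fin n)) : ‖evenSymbol V θ₀ ξ‖ ≤ C := by
  rw [evenSymbol, norm_div, Complex.norm_two, div_le_iff₀ two_pos]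
  have := norm_add_le (V (direction θ₀ ξ)) (V (direction θ₀ (-ξ)))
  linarith [hC (direction θ₀ ξ), hC (direction θ₀ (-ξ))]

/-- The integrand of the Fourier inversion formula. -/
def planeWave (φ : 𝓢(EuclideanSpace ℝ (Fin n), ℂ)) (x ξ : EuclideanSpace ℝ (Fin n)) : ℂ :=
  Real.fourierChar ⟪ξ, x⟫ * 𝓕 φ ξ

lemma continuous_planeWave (φ : 𝓢(EuclideanSpace ℝ (Fin n), ℂ)) (x : EuclideanSpace ℝ (Fin n)) :
    Continuous (planeWave φ x) := by
  unfold planeWave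
  fun_prop

lemma norm_planeWave (φ : 𝓢(EuclideanSpace ℝ (Fin n), ℂ)) (x ξ : EuclideanSpace ℝ (Fin n)) :
    ‖planeWave φ x ξ‖ = ‖𝓕 φ ξ‖ := by
  rw [planeWave, norm_mul, Circle.norm_coe, one_mul]

lemma integrable_planeWave (φ : 𝓢(EuclideanSpace ℝ (Fin n), ℂ)) (x : EuclideanSpace ℝ (Fin n)) :
    Integrable (planeWave φ x) :=
  (𝓕 φ).integrable.norm.mono' (continuous_planeWave φ x).aestronglyMeasurable
    (Eventually.of_forall fun ξ => (norm_planeWave φ x ξ).le)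

lemma integral_planeWave (φ : 𝓢(EuclideanSpace ℝ (Fin n), ℂ)) (x : EuclideanSpace ℝ (Fin n)) :
    ∫ ξ, planeWave φ x ξ = φ x := by
  conv_rhs => rw [← FourierTransform.fourierInv_fourier_eq (F := 𝓢(EuclideanSpace ℝ (Fin n), ℂ)) φ,
    SchwartzMap.fourierInv_coe, Real.fourierInv_eq]
  rfl

/-- Folding the `σ`-line onto `r > 0` pairs the frequencies `±rθ`: the filter becomes the polar
Jacobian, and its factor `1/2` an average. -/
lemma filtered_eq_integral_planeWave (φ : 𝓢(EuclideanSpace ℝ (Fin n), ℂ))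
    (x : EuclideanSpace ℝ (Fin n)) (θ : Sph n) :
    filtered φ θ ⟪x, (θ : EuclideanSpace ℝ (Fin n))⟫ =
      ∫ r in Set.Ioi (0 : ℝ), ((r ^ (n - 1) : ℝ) : ℂ) *
        ((planeWave φ x (r • (θ : EuclideanSpace ℝ (Fin n))) +
          planeWave φ x (-(r • (θ : EuclideanSpace ℝ (Fin n))))) / 2) := by
  set s := ⟪x, (θ : EuclideanSpace ℝ (Fin n))⟫ with hs
  have hi : Integrable fun σ : ℝ => Real.fourierChar (-(σ * s)) • filteredSlice φ θ σ := by
    have := (Real.fourierIntegral_convergent_iff (μ := volume) s).mpr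
      (integrable_filteredSlice φ θ)
    simpa [mul_comm] using this
  have e : ∀ σ : ℝ, Real.fourierChar (-(σ * s)) • filteredSlice φ θ σ =
      1 / 2 * ((|σ| : ℝ) : ℂ) ^ (n - 1) *
        planeWave φ x (-(σ • (θ : EuclideanSpace ℝ (Fin n)))) := by
    intro σ
    rw [filteredSlice, planeWave, slice_apply, Circle.smul_def, smul_eq_mul, inner_neg_left,
      real_inner_smul_left, real_inner_comm, ← hs, neg_smul]
    ring
  have hi' : Integrable fun σ : ℝ => Real.fourierChar (-(-σ * s)) • filteredSlice φ θ (-σ) :=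
    hi.comp_neg
  rw [filtered, Real.fourier_real_eq,
    ← intervalIntegral.integral_Iic_add_Ioi (b := 0) hi.integrableOn hi.integrableOn,
    ← neg_zero, ← integral_comp_neg_Ioi, neg_zero, ← integral_add hi'.integrableOn hi.integrableOn]
  refine setIntegral_congr_fun measurableSet_Ioi fun r hr => ?_
  simp only [e, abs_neg, abs_of_pos (show 0 < r from hr), neg_smul, neg_neg]
  push_cast
  ring

/-- The weighted back-projection is a Fourier multiplier with symbol the even part of `W(x, ·)`,
evaluated at `x`. -/
lemma backproj_eq_integral_evenSymbol {W : EuclideanSpace ℝ (Fin n) × Sph n → ℂ}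
    (hW : Continuous W) {C : ℝ} (hC : ∀ p, ‖W p‖ ≤ C) (φ : 𝓢(EuclideanSpace ℝ (Fin n), ℂ))
    (x : EuclideanSpace ℝ (Fin n)) (θ₀ : Sph n) :
    backproj W φ x = ∫ ξ, evenSymbol (fun θ => W (x, θ)) θ₀ ξ * planeWave φ x ξ := by
  have hV : Continuous fun θ : Sph n => W (x, θ) := hW.comp (Continuous.prodMk_right x)
  have hm : Measurable fun ξ => W (x, direction θ₀ ξ) :=
    hV.measurable.comp (measurable_direction θ₀)
  have hp := integrable_planeWave φ x
  have i1 : Integrable fun ξ => W (x, direction θ₀ ξ) * planeWave φ x ξ :=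
    hp.bdd_mul hm.aestronglyMeasurable (Eventually.of_forall fun ξ => hC _)
  have i2 : Integrable fun ξ => W (x, direction θ₀ ξ) * planeWave φ x (-ξ) :=
    hp.comp_neg.bdd_mul hm.aestronglyMeasurable (Eventually.of_forall fun ξ => hC _)
  have i3 : Integrable fun ξ => W (x, direction θ₀ (-ξ)) * planeWave φ x ξ := by
    simpa using i2.comp_neg
  have hint : Integrable fun ξ => W (x, direction θ₀ ξ) *
      ((planeWave φ x ξ + planeWave φ x (-ξ)) / 2) := by
    refine ((i1.add i2).div_const 2).congr (Eventually.of_forall fun ξ => ?_)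
    simp only [Pi.add_apply]
    ring
  have h1 : backproj W φ x =
      ∫ ξ, W (x, direction θ₀ ξ) * ((planeWave φ x ξ + planeWave φ x (-ξ)) / 2) := by
    have : Nontrivial (EuclideanSpace ℝ (Fin n)) :=
      ⟨θ₀, 0, ne_zero_of_mem_unit_sphere θ₀⟩
    rw [integral_polar hint, backproj]
    congr 1 with θ
    rw [filtered_eq_integral_planeWave, ← integral_const_mul]
    refine setIntegral_congr_fun measurableSet_Ioi fun r hr => ?_
    simp only [direction_pos_smul θ₀ (show 0 < r from hr), direction_self]
    ring
  -- The substitution `ξ ↦ -ξ` transfers the symmetrization from the plane wave to the weight.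
  have h2 : ∫ ξ, W (x, direction θ₀ ξ) * planeWave φ x (-ξ) =
      ∫ ξ, W (x, direction θ₀ (-ξ)) * planeWave φ x ξ := by
    rw [← integral_neg_eq_self]
    simp only [neg_neg]
  calc backproj W φ x
      = ∫ ξ, (W (x, direction θ₀ ξ) * planeWave φ x ξ +
          W (x, direction θ₀ ξ) * planeWave φ x (-ξ)) / 2 := by
        rw [h1]; congr 1 with ξ; ring
    _ = ∫ ξ, (W (x, direction θ₀ ξ) * planeWave φ x ξ +
          W (x, direction θ₀ (-ξ)) * planeWave φ x ξ) / 2 := by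
        rw [integral_div, integral_div, integral_add i1 i2, integral_add i1 i3, h2]
    _ = _ := by
        congr 1 with ξ
        rw [evenSymbol]
        ring

/-! ### Sufficiency of the symmetry condition. -/

lemma continuous_w0 {W : EuclideanSpace ℝ (Fin n) × Sph n → ℂ} (hW : Continuous W) :
    Continuous (w0 W) :=
  continuous_const.mul (continuous_sphere_integral hW)

lemma nonempty_sphere (hn : 2 ≤ n) : Nonempty (Sph n) :=
  ⟨⟨EuclideanSpace.single ⟨0, by omega⟩ 1, by simp⟩⟩

/-- The symbol at `x` is the constant `c` off the origin, so Fourier inversion applies. -/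
lemma backproj_eq_of_even_part {W : EuclideanSpace ℝ (Fin n) × Sph n → ℂ} (hn : 2 ≤ n)
    (hW : Continuous W) {C : ℝ} (hC : ∀ p, ‖W p‖ ≤ C) {x : EuclideanSpace ℝ (Fin n)} {c : ℂ}
    (hc : ∀ θ, W (x, θ) + W (x, -θ) = 2 * c) (φ : 𝓢(EuclideanSpace ℝ (Fin n), ℂ)) :
    backproj W φ x = c * φ x := by
  obtain ⟨θ₀⟩ := nonempty_sphere hn
  have : Nontrivial (EuclideanSpace ℝ (Fin n)) := ⟨θ₀, 0, ne_zero_of_mem_unit_sphere θ₀⟩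
  rw [backproj_eq_integral_evenSymbol hW hC φ x θ₀, ← integral_planeWave, ← integral_const_mul]
  refine integral_congr_ae ?_
  filter_upwards [Measure.ae_ne volume (0 : EuclideanSpace ℝ (Fin n))] with ξ hξ
  rw [evenSymbol, direction_neg θ₀ hξ, hc, mul_div_cancel_left₀ _ two_ne_zero]

lemma changExact_of_even_part {W : EuclideanSpace ℝ (Fin n) × Sph n → ℂ} (hn : 2 ≤ n)
    (hW : Continuous W) {C : ℝ} (hC : ∀ p, ‖W p‖ ≤ C)
    (hsym : ∀ x θ, W (x, θ) - w0 W x = w0 W x - W (x, -θ))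
    {f : EuclideanSpace ℝ (Fin n) → ℂ} (hf : Continuous f) (hfs : HasCompactSupport f) :
    ChangExact W f := by
  intro φ
  have h := changNumerator_eq_integral_backproj hn hW hf hfs
    (φ.hasCompactSupport.toSchwartzMap φ.contDiff) φ.hasCompactSupport
  refine Eq.trans h (integral_congr_ae (Eventually.of_forall fun x => ?_))
  have hb := backproj_eq_of_even_part hn hW hC (x := x) (c := w0 W x)
    (fun θ => by linear_combination hsym x θ) (φ.hasCompactSupport.toSchwartzMap φ.contDiff)
  simp only [hb]
  change f x * (w0 W x * φ x) = w0 W x * f x * φ x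
  ring

/-! ### Necessity: recovering the symbol at high frequency. -/

/-- The roles are exchanged: `φ` is fixed and `f` runs over real smooth bumps, giving equality
almost everywhere, hence everywhere by continuity. -/
lemma backproj_eq_of_changExact {W : EuclideanSpace ℝ (Fin n) × Sph n → ℂ} (hn : 2 ≤ n)
    (hW : Continuous W)
    (h : ∀ f : EuclideanSpace ℝ (Fin n) → ℂ, Continuous f → HasCompactSupport f →
      ChangExact W f)
    (φ : 𝓢(EuclideanSpace ℝ (Fin n), ℂ)) (hφ : HasCompactSupport φ)
    (x : EuclideanSpace ℝ (Fin n)) : backproj W φ x = w0 W x * φ x := by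
  have hb := continuous_backproj hW φ
  have hw : Continuous fun x => w0 W x * φ x := (continuous_w0 hW).mul φ.continuous
  suffices backproj W φ = fun x => w0 W x * φ x from congrFun this x
  refine (hb.ae_eq_iff_eq (μ := volume) hw).mp (ae_eq_of_integral_contDiff_smul_eq
    hb.locallyIntegrable hw.locallyIntegrable fun χ hχ hχs => ?_)
  have hf : Continuous fun x => (χ x : ℂ) := Complex.continuous_ofReal.comp hχ.continuous
  have hfs : HasCompactSupport fun x => (χ x : ℂ) :=
    hχs.comp_left (g := ((↑) : ℝ → ℂ)) Complex.ofReal_zero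
  have e := h _ hf hfs ⟨φ, φ.smooth ⊤, hφ, fun _ _ => trivial⟩
  have e' := changNumerator_eq_integral_backproj hn hW hf hfs φ hφ
  simp only [Complex.real_smul]
  rw [← e']
  refine Eq.trans e (integral_congr_ae (Eventually.of_forall fun x => ?_))
  change w0 W x * χ x * φ x = χ x * (w0 W x * φ x)
  ring

lemma evenSymbol_pos_smul (V : Sph n → ℂ) (θ₀ : Sph n) {r : ℝ} (hr : 0 < r)
    (ξ : EuclideanSpace ℝ (Fin n)) : evenSymbol V θ₀ (r • ξ) = evenSymbol V θ₀ ξ := by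
  rw [evenSymbol, ← smul_neg, direction_pos_smul θ₀ hr, direction_pos_smul θ₀ hr, evenSymbol]

/-- By homogeneity of degree `0` the value equals that at `t⁻¹ η + ω`, which tends to `ω`, a point
of continuity. -/
lemma tendsto_evenSymbol {V : Sph n → ℂ} (hV : Continuous V) (θ₀ ω : Sph n)
    (η : EuclideanSpace ℝ (Fin n)) :
    Tendsto (fun t : ℝ => evenSymbol V θ₀ (η + t • (ω : EuclideanSpace ℝ (Fin n)))) atTop
      (𝓝 ((V ω + V (-ω)) / 2)) := by
  have hω : (ω : EuclideanSpace ℝ (Fin n)) ≠ 0 := ne_zero_of_mem_unit_sphere ω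
  have hcont : ContinuousAt (evenSymbol V θ₀) (ω : EuclideanSpace ℝ (Fin n)) := by
    have h1 := hV.continuousAt.comp (continuousAt_direction θ₀ hω)
    have h2 := hV.continuousAt.comp ((continuousAt_direction θ₀ (neg_ne_zero.mpr hω)).comp
      continuousAt_neg)
    exact (h1.add h2).div_const 2
  have hval : evenSymbol V θ₀ (ω : EuclideanSpace ℝ (Fin n)) = (V ω + V (-ω)) / 2 := by
    rw [evenSymbol, direction_neg θ₀ hω, direction_self]
  have hlim : Tendsto (fun t : ℝ => t⁻¹ • η + (ω : EuclideanSpace ℝ (Fin n))) atTop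
      (𝓝 (ω : EuclideanSpace ℝ (Fin n))) := by
    have := ((tendsto_inv_atTop_zero (𝕜 := ℝ)).smul_const η).add_const
      (ω : EuclideanSpace ℝ (Fin n))
    simpa using this
  rw [← hval]
  refine (hcont.tendsto.comp hlim).congr' ?_
  filter_upwards [eventually_gt_atTop 0] with t ht
  rw [Function.comp_apply, ← evenSymbol_pos_smul V θ₀ ht, smul_add, smul_smul,
    mul_inv_cancel₀ ht.ne', one_smul]

/-- The modulation `e^{2π i y·v} ρ(y)` of a Schwartz function with compact support. -/
def modulate (ρ : 𝓢(EuclideanSpace ℝ (Fin n), ℂ)) (hρ : HasCompactSupport ρ)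
    (v : EuclideanSpace ℝ (Fin n)) : 𝓢(EuclideanSpace ℝ (Fin n), ℂ) :=
  HasCompactSupport.toSchwartzMap
    (f := fun y => Complex.exp (((2 * Real.pi * ⟪y, v⟫ : ℝ) : ℂ) * Complex.I) * ρ y)
    hρ.mul_left
    (((Complex.ofRealCLM.contDiff.comp
      (contDiff_const.mul (contDiff_id.inner ℝ contDiff_const))).mul
        contDiff_const).cexp.mul (ρ.smooth ⊤))

lemma modulate_apply (ρ : 𝓢(EuclideanSpace ℝ (Fin n), ℂ)) (hρ : HasCompactSupport ρ)
    (v y : EuclideanSpace ℝ (Fin n)) :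
    modulate ρ hρ v y = Real.fourierChar ⟪y, v⟫ * ρ y := by
  rw [Real.fourierChar_apply]
  rfl

lemma planeWave_modulate (ρ : 𝓢(EuclideanSpace ℝ (Fin n), ℂ)) (hρ : HasCompactSupport ρ)
    (v x ξ : EuclideanSpace ℝ (Fin n)) :
    planeWave (modulate ρ hρ v) x ξ = Real.fourierChar ⟪x, v⟫ * planeWave ρ x (ξ - v) := by
  have h : 𝓕 (modulate ρ hρ v) ξ = 𝓕 ρ (ξ - v) := by
    rw [SchwartzMap.fourier_coe, SchwartzMap.fourier_coe, Real.fourier_eq, Real.fourier_eq]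
    congr 1 with y
    rw [modulate_apply, Circle.smul_def, Circle.smul_def, smul_eq_mul, smul_eq_mul, ← mul_assoc,
      ← Circle.coe_mul, ← AddChar.map_add_eq_mul, inner_sub_right]
    congr 3
    ring
  rw [planeWave, planeWave, h, ← mul_assoc, ← Circle.coe_mul, ← AddChar.map_add_eq_mul,
    inner_sub_left, real_inner_comm v x, add_sub_cancel]

lemma even_part_of_backproj_eq {W : EuclideanSpace ℝ (Fin n) × Sph n → ℂ}
    (hW : Continuous W) {C : ℝ} (hC : ∀ p, ‖W p‖ ≤ C) {x : EuclideanSpace ℝ (Fin n)} {c : ℂ}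
    (h : ∀ φ : 𝓢(EuclideanSpace ℝ (Fin n), ℂ), HasCompactSupport φ →
      backproj W φ x = c * φ x) (ω : Sph n) :
    (W (x, ω) + W (x, -ω)) / 2 = c := by
  let b : ContDiffBump x := default
  let ρ : 𝓢(EuclideanSpace ℝ (Fin n), ℂ) := HasCompactSupport.toSchwartzMap
    (f := fun y => (b y : ℂ)) (b.hasCompactSupport.comp_left (g := ((↑) : ℝ → ℂ))
      Complex.ofReal_zero) (Complex.ofRealCLM.contDiff.comp b.contDiff)
  have hρ : HasCompactSupport ρ :=
    b.hasCompactSupport.comp_left (g := ((↑) : ℝ → ℂ)) Complex.ofReal_zero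
  have hρx : ρ x = 1 := by
    change ((b x : ℝ) : ℂ) = 1
    rw [b.one_of_mem_closedBall (Metric.mem_closedBall_self b.rIn_pos.le), Complex.ofReal_one]
  have hV : Continuous fun θ : Sph n => W (x, θ) := hW.comp (Continuous.prodMk_right x)
  -- Modulation by `v = tω` translates `𝓕 ρ`; a change of variable moves the shift into the symbol,
  -- and the phase `e^{2πi x·v}` cancels on both sides because `ρ x = 1`. The integral is thus
  -- independent of `t`.
  have key : ∀ t : ℝ, ∫ η, evenSymbol (fun θ => W (x, θ)) ω
      (η + t • (ω : EuclideanSpace ℝ (Fin n))) * planeWave ρ x η = c := by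
    intro t
    set v := t • (ω : EuclideanSpace ℝ (Fin n)) with hv
    have e := h (modulate ρ hρ v) (by
      rw [show ⇑(modulate ρ hρ v) = fun y => (Real.fourierChar ⟪y, v⟫ : ℂ) * ρ y from
        funext (modulate_apply ρ hρ v)]
      exact hρ.mul_left)
    rw [backproj_eq_integral_evenSymbol hW hC _ x ω, modulate_apply, hρx, mul_one,
      ← integral_add_right_eq_self _ v] at e
    simp_rw [planeWave_modulate, add_sub_cancel_right, mul_left_comm _
      ((Real.fourierChar ⟪x, v⟫ : Circle) : ℂ)] at e
    rw [integral_const_mul, mul_comm c] at e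
    exact mul_left_cancel₀ (Circle.coe_ne_zero _) e
  have hlim : Tendsto (fun t : ℝ => ∫ η, evenSymbol (fun θ => W (x, θ)) ω
      (η + t • (ω : EuclideanSpace ℝ (Fin n))) * planeWave ρ x η) atTop
      (𝓝 (∫ η, (W (x, ω) + W (x, -ω)) / 2 * planeWave ρ x η)) := by
    refine tendsto_integral_filter_of_dominated_convergence (fun η => C * ‖planeWave ρ x η‖)
      (Eventually.of_forall fun t => ?_)
      (Eventually.of_forall fun t => Eventually.of_forall fun η => ?_)
      ((integrable_planeWave ρ x).norm.const_mul C) (Eventually.of_forall fun η => ?_)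
    · exact ((measurable_evenSymbol hV ω).comp
        (measurable_id.add_const _)).aestronglyMeasurable.mul
        (continuous_planeWave ρ x).aestronglyMeasurable
    · rw [norm_mul]
      gcongr
      exact norm_evenSymbol_le (fun θ => hC (x, θ)) ω _
    · exact (tendsto_evenSymbol hV ω ω η).mul_const _
  simp_rw [key] at hlim
  rw [integral_const_mul, integral_planeWave, hρx, mul_one] at hlim
  exact tendsto_nhds_unique hlim tendsto_const_nhds

end ChangRadon

end

theorem theorem1 (n : ℕ) (hn : 2 ≤ n)
    (W : EuclideanSpace ℝ (Fin n) × ChangRadon.Sph n → ℂ)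
    (hWcont : Continuous W) (hWbdd : ∃ C : ℝ, ∀ p, ‖W p‖ ≤ C)
    (hw0 : ∀ x, ChangRadon.w0 W x ≠ 0) :
    (∀ f : EuclideanSpace ℝ (Fin n) → ℂ, Continuous f → HasCompactSupport f →
        ChangRadon.ChangExact W f) ↔
      ∀ (x : EuclideanSpace ℝ (Fin n)) (θ : ChangRadon.Sph n),
        W (x, θ) - ChangRadon.w0 W x = ChangRadon.w0 W x - W (x, -θ) := by
  obtain ⟨C, hC⟩ := hWbdd
  refine ⟨fun h x θ => ?_, fun h f hf hfs =>
    ChangRadon.changExact_of_even_part hn hWcont hC h hf hfs⟩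
  have key := ChangRadon.even_part_of_backproj_eq hWcont hC (x := x)
    (fun φ hφ => ChangRadon.backproj_eq_of_changExact hn hWcont h φ hφ x) θ
  linear_combination 2 * key
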